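/- Let $\tilde\Omega\subseteq\mathbb C$ be a domain and let $\rho:\tilde\Omega\to(0,\infty)$ be a smooth function such that the conformal metric $\rho(w)|dw|$ is flat, i.e. its Gaussian curvature $-\rho^{-2}\,\Delta\log\rho$ vanishes identically on $\tilde\Omega$. Let $f:\mathbb C\to\tilde\Omega$ be an orientation-preserving homeomorphism of $\mathbb C$ onto $\tilde\Omega$ which is of class $C^2$ and harmonic with respect to $\rho$, i.e. satisfies the tension equation $$f_{z\bar z}(z)+(\log\rho)_w(f(z))\,f_z(z)\,f_{\bar z}(z)=0\qquad(z\in\mathbb C).$$ (Orientation-preserving means that the Jacobian determinant satisfies $J(z,f)\ge 0$ for all $z$.) Then $f_z$ has no zeros, and there is a constant $k\in[0,1)$ such that the Beltrami coefficient $\mu_f=f_{\bar z}/f_z$ satisfies $|\mu_f(z)|=k$ for every $z\in\mathbb C$. Moreover $f$ is $\frac{1+k}{1-k}$-quasiconformal, and $\tilde\Omega=\mathbb C$. (Here $f$ is $K$-quasiconformal if it is a homeomorphism in $W^{1,2}_{\mathrm{loc}}$ with $|f_z|+|f_{\bar z}|\le K\,(|f_z|-|f_{\bar z}|)$ almost everywhere.)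 -/

import Mathlib

open Set MeasureTheory Laplacian
open scoped ContDiff

noncomputable section

namespace HarmonicPlane

/-- The Wirtinger derivative `f_z = (f_x - i f_y) / 2`. -/
def wirtingerZ (f : ℂ → ℂ) (z : ℂ) : ℂ :=
  (fderiv ℝ f z 1 - Complex.I * fderiv ℝ f z Complex.I) / 2

/-- The Wirtinger derivative `f_{z̄} = (f_x + i f_y) / 2`. -/
def wirtingerZbar (f : ℂ → ℂ) (z : ℂ) : ℂ :=
  (fderiv ℝ f z 1 + Complex.I * fderiv ℝ f z Complex.I) / 2

/-- A domain in the plane: a nonempty connected open set. -/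
def IsPlaneDomain (U : Set ℂ) : Prop := IsOpen U ∧ IsConnected U

/-- `ρ(w)|dw|` is a conformal metric on `V`: the density is smooth and positive. -/
structure IsConformalMetricOn (ρ : ℂ → ℝ) (V : Set ℂ) : Prop where
  smooth : ContDiffOn ℝ ∞ ρ V
  pos : ∀ w ∈ V, 0 < ρ w

/-- The Gaussian curvature `-ρ⁻² Δ log ρ` of the metric `ρ(w)|dw|`. -/
def gaussianCurvature (ρ : ℂ → ℝ) (w : ℂ) : ℝ :=
  -((ρ w) ^ 2)⁻¹ * (Δ (fun x : ℂ => Real.log (ρ x))) w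

/-- The metric `ρ(w)|dw|` is flat on `V`. -/
def IsFlatOn (ρ : ℂ → ℝ) (V : Set ℂ) : Prop := ∀ w ∈ V, gaussianCurvature ρ w = 0

/-- `(log ρ)_w`. -/
def logDensityZ (ρ : ℂ → ℝ) (w : ℂ) : ℂ :=
  wirtingerZ (fun x => ((Real.log (ρ x) : ℝ) : ℂ)) w

/-- `f : U → (V, ρ)` is harmonic: a `C²` map of `U` into `V` that solves the tension equation
`f_{z z̄} + (log ρ)_w(f) f_z f_{z̄} = 0` on `U`. -/
structure IsHarmonicMap (f : ℂ → ℂ) (U V : Set ℂ) (ρ : ℂ → ℝ) : Prop where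
  mapsTo : MapsTo f U V
  contDiffOn : ContDiffOn ℝ 2 f U
  tension : ∀ z ∈ U, wirtingerZbar (wirtingerZ f) z +
    logDensityZ ρ (f z) * wirtingerZ f z * wirtingerZbar f z = 0

/-- `f` restricts to a homeomorphism of `U` onto `V`. -/
def IsHomeoBetween (f : ℂ → ℂ) (U V : Set ℂ) : Prop :=
  ∃ e : U ≃ₜ V, ∀ z : U, (e z : ℂ) = f z

/-- The Jacobian determinant `J(z, f)`. -/
def jacobian (f : ℂ → ℂ) (z : ℂ) : ℝ := (fderiv ℝ f z).det

/-- Orientation preservation for differentiable homeomorphisms: the Jacobian determinant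
is nowhere negative (it may vanish). -/
def IsOrientationPreservingOn (f : ℂ → ℂ) (U : Set ℂ) : Prop := ∀ z ∈ U, 0 ≤ jacobian f z

/-- The Beltrami coefficient (complex dilatation) `μ_f = f_{z̄} / f_z`, meaningful where
`f_z ≠ 0`. -/
def beltrami (f : ℂ → ℂ) (z : ℂ) : ℂ := wirtingerZbar f z / wirtingerZ f z

/-- `g` lies in `L²_loc(U)`. -/
def IsLocallyL2On (g : ℂ → ℂ) (U : Set ℂ) : Prop :=
  ∀ C : Set ℂ, IsCompact C → C ⊆ U → MemLp g 2 (volume.restrict C)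

/-- Smooth complex-valued test functions with compact support in `U`. -/
structure IsTestFunction (φ : ℂ → ℂ) (U : Set ℂ) : Prop where
  smooth : ContDiff ℝ ∞ φ
  hasCompactSupport : HasCompactSupport φ
  tsupport_subset : tsupport φ ⊆ U

/-- `p` and `q` are the weak derivatives `f_z` and `f_{z̄}` of `f` on `U`. -/
def HasWeakWirtinger (f p q : ℂ → ℂ) (U : Set ℂ) : Prop :=
  ∀ φ : ℂ → ℂ, IsTestFunction φ U →
    ∫ z in U, f z * wirtingerZ φ z = -∫ z in U, p z * φ z ∧
    ∫ z in U, f z * wirtingerZbar φ z = -∫ z in U, q z * φ z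

/-- The analytic definition of a `K`-quasiconformal map of `U` onto `V`: a homeomorphism in
`W^{1,2}_loc(U)` with `|f_z| + |f_{z̄}| ≤ K (|f_z| - |f_{z̄}|)` almost everywhere, `1 ≤ K`.
(The inequality contains orientation preservation.) -/
structure IsQuasiconformal (K : ℝ) (f : ℂ → ℂ) (U V : Set ℂ) : Prop where
  one_le : 1 ≤ K
  homeo : IsHomeoBetween f U V
  sobolev : ∃ p q : ℂ → ℂ, HasWeakWirtinger f p q U ∧ IsLocallyL2On p U ∧ IsLocallyL2On q U ∧
    ∀ᵐ z ∂(volume.restrict U), ‖p z‖ + ‖q z‖ ≤ K * (‖p z‖ - ‖q z‖)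

end HarmonicPlane

end

namespace HarmonicPlane

open Complex Filter Topology
open scoped ComplexConjugate

/-! Flatness makes log ρ harmonic, so p = (log ρ)_w is holomorphic. Since the plane is simply
connected, the closed form p(f) df has a global primitive h (`exists_pullback_primitive`), and the
tension equation says exactly that A = e^h f_z and B = conj(e^h f_z̄) are entire
(`exists_integrating_factor`).

Orientation gives |B| ≤ |A|, so B = cA by Liouville, and k = |c|. The image is open, so by Sard the
Jacobian is not identically zero, which forces k < 1. Locally choose φ with φ''/φ' = p. Then φ ∘ f =
H + conj(cH) up to a constant, with H' = A. Injectivity of f passes to H, hence A and f_z have no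
zeros (`wirtingerZ_ne_zero_of_injective`).

If f omitted w₀, a square root S of f - w₀ would stay away from -S(0), because f is a homeomorphism
onto its image. Then 1/(S + S(0)) is bounded with dilatation at most k. A Caccioppoli estimate with
logarithmic cutoffs makes its z-derivative vanish, contradicting f_z(0) ≠ 0
(`surjective_of_norm_wirtingerZbar_le`). -/

/-! ### Wirtinger calculus and primitives of pulled-back forms. -/

theorem fderiv_apply_eq_wirtinger (f : ℂ → ℂ) (z v : ℂ) :
    fderiv ℝ f z v = wirtingerZ f z * v + wirtingerZbar f z * conj v := by
  have h : v = v.re • (1 : ℂ) + v.im • I := by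
    simp [Complex.re_add_im]
  have h' : conj v = v.re - v.im * I := by
    apply Complex.ext <;> simp
  conv_lhs => rw [h, map_add, map_smul, map_smul]
  rw [h']
  conv_rhs => enter [1, 2]; rw [← Complex.re_add_im v]
  simp only [wirtingerZ, wirtingerZbar, real_smul]
  linear_combination (v.im * fderiv ℝ f z I : ℂ) * I_sq

theorem wirtinger_of_hasFDerivAt {f : ℂ → ℂ} {L : ℂ →L[ℝ] ℂ} {z a b : ℂ}
    (h : HasFDerivAt f L z) (hL : ∀ v, L v = a * v + b * conj v) :
    wirtingerZ f z = a ∧ wirtingerZbar f z = b := by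
  simp only [wirtingerZ, wirtingerZbar, h.fderiv, hL, map_one, conj_I]
  constructor
  · linear_combination ((b - a) / 2) * I_sq
  · linear_combination ((a - b) / 2) * I_sq

theorem jacobian_eq (f : ℂ → ℂ) (z : ℂ) :
    jacobian f z = ‖wirtingerZ f z‖ ^ 2 - ‖wirtingerZbar f z‖ ^ 2 := by
  have h : jacobian f z = (fderiv ℝ f z 1).re * (fderiv ℝ f z I).im
      - (fderiv ℝ f z I).re * (fderiv ℝ f z 1).im := by
    rw [jacobian, ContinuousLinearMap.det, ← LinearMap.det_toMatrix basisOneI,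
      Matrix.det_fin_two]
    simp [LinearMap.toMatrix_apply]
  rw [h, ← normSq_eq_norm_sq, ← normSq_eq_norm_sq, normSq_apply, normSq_apply, wirtingerZ,
    wirtingerZbar]
  simp
  ring

theorem wirtinger_mul {f g : ℂ → ℂ} {z : ℂ} (hf : DifferentiableAt ℝ f z)
    (hg : DifferentiableAt ℝ g z) :
    wirtingerZ (fun x => f x * g x) z = wirtingerZ f z * g z + f z * wirtingerZ g z ∧
    wirtingerZbar (fun x => f x * g x) z = wirtingerZbar f z * g z + f z * wirtingerZbar g z := by
  refine wirtinger_of_hasFDerivAt (hf.hasFDerivAt.mul hg.hasFDerivAt) fun v => ?_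
  simp only [add_apply, smul_apply, smul_eq_mul,
    fderiv_apply_eq_wirtinger]
  ring

theorem wirtinger_conj {f : ℂ → ℂ} {z : ℂ} (hf : DifferentiableAt ℝ f z) :
    wirtingerZ (fun x => conj (f x)) z = conj (wirtingerZbar f z) ∧
    wirtingerZbar (fun x => conj (f x)) z = conj (wirtingerZ f z) := by
  refine wirtinger_of_hasFDerivAt (conjCLE.hasFDerivAt.comp z hf.hasFDerivAt) fun v => ?_
  simp [fderiv_apply_eq_wirtinger]
  ring

theorem HasFDerivAt.of_comp_holomorphic {p f : ℂ → ℂ} {p' z : ℂ} (hp : HasDerivAt p p' (f z))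
    (hf : DifferentiableAt ℝ f z) :
    HasFDerivAt (fun x => p (f x)) (p' • fderiv ℝ f z) z := by
  refine (hp.complexToReal_fderiv.comp z hf.hasFDerivAt).congr_fderiv ?_
  ext
  simp

theorem wirtinger_comp {p f : ℂ → ℂ} {p' z : ℂ} (hp : HasDerivAt p p' (f z))
    (hf : DifferentiableAt ℝ f z) :
    wirtingerZ (fun x => p (f x)) z = p' * wirtingerZ f z ∧
    wirtingerZbar (fun x => p (f x)) z = p' * wirtingerZbar f z := by
  refine wirtinger_of_hasFDerivAt (HasFDerivAt.of_comp_holomorphic hp hf) fun v => ?_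
  simp [fderiv_apply_eq_wirtinger]
  ring

theorem contDiff_wirtinger {f : ℂ → ℂ} {m n : ℕ∞ω} (hf : ContDiff ℝ n f) (hmn : m + 1 ≤ n) :
    ContDiff ℝ m (wirtingerZ f) ∧ ContDiff ℝ m (wirtingerZbar f) := by
  have h := hf.fderiv_right hmn
  have h1 := h.clm_apply (contDiff_const (c := (1 : ℂ)))
  have hI := h.clm_apply (contDiff_const (c := I))
  exact ⟨(h1.sub (contDiff_const.mul hI)).div_const 2, (h1.add (contDiff_const.mul hI)).div_const 2⟩

theorem differentiableAt_of_wirtingerZbar_eq_zero {f : ℂ → ℂ} {z : ℂ}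
    (hf : DifferentiableAt ℝ f z) (h : wirtingerZbar f z = 0) :
    HasDerivAt f (wirtingerZ f z) z := by
  rw [hasDerivAt_iff_hasFDerivAt]
  refine hasFDerivAt_of_restrictScalars ℝ hf.hasFDerivAt ?_
  ext v
  simp [fderiv_apply_eq_wirtinger, h, mul_comm]

theorem wirtingerZ_wirtingerZbar_comm {f : ℂ → ℂ} (hf : ContDiff ℝ 2 f) (z : ℂ) :
    wirtingerZ (wirtingerZbar f) z = wirtingerZbar (wirtingerZ f) z := by
  have hd : DifferentiableAt ℝ (fderiv ℝ f) z :=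
    (hf.fderiv_right (m := 1) (by norm_num)).differentiable (by simp) z
  have happ (v : ℂ) : HasFDerivAt (fun x => fderiv ℝ f x v)
      ((fderiv ℝ (fderiv ℝ f) z).flip v) z := by
    simpa using hd.hasFDerivAt.clm_apply (hasFDerivAt_const v z)
  have hZ : fderiv ℝ (wirtingerZ f) z = _ :=
    (((happ 1).sub ((happ I).const_mul I)).mul_const ((2 : ℂ)⁻¹)).fderiv
  have hZb : fderiv ℝ (wirtingerZbar f) z = _ :=
    (((happ 1).add ((happ I).const_mul I)).mul_const ((2 : ℂ)⁻¹)).fderiv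
  have hsymm := (hf.contDiffAt (x := z)).isSymmSndFDerivAt (by simp) 1 I
  rw [wirtingerZ, wirtingerZbar, hZ, hZb]
  simp [hsymm]
  ring

/-- The pullback of a holomorphic `1`-form `p dw` by a `C²` map of the plane is exact. -/
theorem exists_pullback_primitive {f p : ℂ → ℂ} {V : Set ℂ} (hf : ContDiff ℝ 2 f)
    (hV : IsOpen V) (hfV : ∀ z, f z ∈ V) (hp : DifferentiableOn ℂ p V) :
    ∃ h : ℂ → ℂ, ContDiff ℝ 2 h ∧ ∀ z, HasFDerivAt h (p (f z) • fderiv ℝ f z) z := by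
  have hpf : ContDiff ℝ 1 (fun z => p (f z)) := by
    rw [contDiff_iff_contDiffAt]
    intro z
    have h1 : ContDiffAt ℝ 1 p (f z) :=
      ((hp.contDiffOn hV).contDiffAt (hV.mem_nhds (hfV z))).restrict_scalars ℝ
    exact h1.comp z (hf.of_le (by norm_num)).contDiffAt
  have hDf : ContDiff ℝ 1 (fderiv ℝ f) := hf.fderiv_right (by norm_num)
  have hω : ContDiff ℝ 1 (fun z => p (f z) • fderiv ℝ f z) := hpf.smul hDf
  obtain ⟨h, hh⟩ := (convex_univ (𝕜 := ℝ) (E := ℂ)).exists_forall_hasFDerivAt_of_fderiv_symmetric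
    isOpen_univ (hω.differentiable (by simp)).differentiableOn (fun a _ x y => by
      have hpd := (hp.differentiableAt (hV.mem_nhds (hfV a))).hasDerivAt
      have hfd := hf.differentiable (by simp) a
      -- Closedness: the derivative of the form is p'(f) Df(x) Df(y) + p(f) D²f(x, y), and both
      -- terms are symmetric in x and y.
      have := (HasFDerivAt.of_comp_holomorphic hpd hfd).smul
        (hDf.differentiable (by simp) a).hasFDerivAt
      have hsymm := (hf.contDiffAt (x := a)).isSymmSndFDerivAt (by simp) x y
      erw [this.fderiv]
      simp [hsymm]
      ring)
  have hh' (z : ℂ) := hh z (mem_univ z)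
  refine ⟨h, ?_, hh'⟩
  rw [show (2 : ℕ∞ω) = 1 + 1 by norm_num, contDiff_succ_iff_fderiv]
  refine ⟨fun z => (hh' z).differentiableAt, by simp, ?_⟩
  convert hω using 1
  ext1 z
  exact (hh' z).fderiv

/-! ### Injective analytic functions. -/

/-- A locally injective analytic function has nonvanishing derivative. -/
theorem AnalyticAt.deriv_ne_zero_of_injOn {h : ℂ → ℂ} {z₀ : ℂ} {U : Set ℂ}
    (hh : AnalyticAt ℂ h z₀) (hU : U ∈ 𝓝 z₀) (hinj : InjOn h U) : deriv h z₀ ≠ 0 := by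
  intro hd
  have hsub : AnalyticAt ℂ (fun z => h z - h z₀) z₀ := hh.sub analyticAt_const
  have hfin : analyticOrderAt (fun z => h z - h z₀) z₀ ≠ ⊤ := by
    rw [Ne, analyticOrderAt_eq_top]
    intro hev
    have hw : ∃ᶠ z in 𝓝[≠] z₀, z ∈ U ∧ h z = h z₀ ∧ z ≠ z₀ := by
      refine Eventually.frequently ?_
      filter_upwards [nhdsWithin_le_nhds hU, nhdsWithin_le_nhds hev, self_mem_nhdsWithin]
        with z h1 h2 h3
      exact ⟨h1, sub_eq_zero.1 h2, h3⟩
    obtain ⟨z, h1, h2, h3⟩ := hw.exists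
    exact h3 (hinj h1 (mem_of_mem_nhds hU) h2)
  obtain ⟨u, hu, hu0, hev⟩ := hsub.analyticOrderAt_ne_top.1 hfin
  set n := analyticOrderNatAt (fun z => h z - h z₀) z₀ with hn
  have hn0 : n ≠ 0 := by
    intro h0
    have := hev.self_of_nhds
    simp [h0] at this
    exact hu0 this.symm
  have hn1 : n ≠ 1 := by
    intro h1
    have hder : HasDerivAt (fun z => (z - z₀) * u z) (u z₀) z₀ := by
      simpa using! ((hasDerivAt_id z₀).sub_const z₀).mul hu.differentiableAt.hasDerivAt
    have hder2 : HasDerivAt (fun z => h z - h z₀) (u z₀) z₀ := by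
      refine hder.congr_of_eventuallyEq ?_
      filter_upwards [hev] with z hz
      simpa [h1] using hz
    have := (hh.differentiableAt.hasDerivAt.sub_const (h z₀)).unique hder2
    exact hu0 (by rw [← this, hd])
  have hnC : (n : ℂ) ≠ 0 := by exact_mod_cast hn0
  -- A local n-th root r of u gives h - h z₀ = t ^ n, with t = (z - z₀) r a local coordinate. Since
  -- n ≥ 2, the coordinate values w and ζw, for ζ a primitive n-th root of unity, violate
  -- injectivity.
  obtain ⟨b, hb⟩ := IsAlgClosed.exists_pow_nat_eq (u z₀) (Nat.pos_of_ne_zero hn0)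
  have hb0 : b ≠ 0 := by
    rintro rfl
    rw [zero_pow hn0] at hb
    exact hu0 hb.symm
  set r : ℂ → ℂ := fun z => b * exp (log (u z / u z₀) / n) with hr
  have hslit : u z₀ / u z₀ ∈ slitPlane := by rw [div_self hu0]; exact one_mem_slitPlane
  have hquot : AnalyticAt ℂ (fun z => u z / u z₀) z₀ := hu.div analyticAt_const hu0
  have hra : AnalyticAt ℂ r z₀ :=
    analyticAt_const.mul (((hquot.clog hslit).div analyticAt_const hnC).cexp)
  have hrpow : ∀ᶠ z in 𝓝 z₀, r z ^ n = u z := by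
    filter_upwards [hu.continuousAt.eventually_ne hu0] with z hz
    rw [hr, mul_pow, hb, ← exp_nat_mul, mul_div_cancel₀ _ hnC, exp_log (div_ne_zero hz hu0),
      mul_div_cancel₀ _ hu0]
  have hr0 : r z₀ ≠ 0 := mul_ne_zero hb0 (exp_ne_zero _)
  set t : ℂ → ℂ := fun z => (z - z₀) * r z with ht
  have hta : AnalyticAt ℂ t z₀ := (analyticAt_id.sub analyticAt_const).mul hra
  have htd : HasStrictDerivAt t (r z₀) z₀ := by
    have h1 : HasDerivAt t (r z₀) z₀ := by
      simpa using! ((hasDerivAt_id z₀).sub_const z₀).mul hra.differentiableAt.hasDerivAt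
    have h2 := hta.hasStrictDerivAt
    rwa [h1.deriv] at h2
  have hmap : map t (𝓝 z₀) = 𝓝 0 := by
    rw [htd.map_nhds_eq hr0]
    simp [ht]
  set W : Set ℂ := {z | z ∈ U ∧ h z - h z₀ = t z ^ n}
  have hW : W ∈ 𝓝 z₀ := by
    filter_upwards [hU, hev, hrpow] with z h1 h2 h3
    refine ⟨h1, ?_⟩
    rw [h2, ht, mul_pow, h3, smul_eq_mul]
  have hWt : t '' W ∈ 𝓝 (0 : ℂ) := hmap ▸ image_mem_map hW
  set ζ : ℂ := exp (2 * Real.pi * I / n)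
  have hζ : IsPrimitiveRoot ζ n := isPrimitiveRoot_exp n hn0
  have hζW : {w | ζ * w ∈ t '' W} ∈ 𝓝 (0 : ℂ) :=
    (continuous_const_mul ζ).continuousAt.preimage_mem_nhds (by simpa using hWt)
  have hex : ∃ᶠ w in 𝓝[≠] (0 : ℂ), w ∈ t '' W ∧ ζ * w ∈ t '' W ∧ w ≠ 0 := by
    refine Eventually.frequently ?_
    filter_upwards [nhdsWithin_le_nhds hWt, nhdsWithin_le_nhds hζW, self_mem_nhdsWithin]
      with w h1 h2 h3 using ⟨h1, h2, h3⟩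
  obtain ⟨w, ⟨z₁, hz₁, rfl⟩, ⟨z₂, hz₂, h12⟩, hw0⟩ := hex.exists
  have heq : h z₂ = h z₁ := by
    have := hz₂.2
    rw [h12, mul_pow, hζ.pow_eq_one, one_mul, ← hz₁.2] at this
    exact sub_left_injective this
  have hz := hinj hz₂.1 hz₁.1 heq
  rw [hz] at h12
  have : ζ = 1 := mul_right_cancel₀ hw0 (by rw [one_mul]; exact h12.symm)
  exact hζ.ne_one (by omega) this

/-! ### Parabolicity of the plane: logarithmic cutoffs. -/

theorem exists_abs_deriv_smoothTransition_le :
    ∃ C, 0 ≤ C ∧ ∀ x, |deriv Real.smoothTransition x| ≤ C := by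
  have hc : Continuous (deriv Real.smoothTransition) :=
    (Real.smoothTransition.contDiff (n := 1)).continuous_deriv le_rfl
  obtain ⟨C, hC⟩ := (isCompact_Icc (a := (0 : ℝ)) (b := 1)).exists_bound_of_continuousOn
    hc.continuousOn
  have hC0 : 0 ≤ C := (norm_nonneg _).trans (hC 0 (by simp))
  refine ⟨C, hC0, fun x => ?_⟩
  rcases lt_or_ge x 0 with h0 | h0
  · have : Real.smoothTransition =ᶠ[𝓝 x] fun _ => 0 := by
      filter_upwards [Iio_mem_nhds h0] with y hy using Real.smoothTransition.zero_of_nonpos hy.le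
    simpa [this.deriv_eq] using hC0
  rcases lt_or_ge 1 x with h1 | h1
  · have : Real.smoothTransition =ᶠ[𝓝 x] fun _ => 1 := by
      filter_upwards [Ioi_mem_nhds h1] with y hy using Real.smoothTransition.one_of_one_le hy.le
    simpa [this.deriv_eq] using hC0
  · exact hC x ⟨h0, h1⟩

/-- This is the radial energy integral. With N = e^R it is O(R), which loses against the factor 1/R²
in the cutoff's energy. -/
theorem integral_div_one_add_sq_le {N : ℝ} (hN : 1 ≤ N) :
    ∫ y in (0 : ℝ)..N, y / (1 + y ^ 2) ≤ Real.log 2 / 2 + Real.log N := by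
  have hd (y : ℝ) : HasDerivAt (fun y => Real.log (1 + y ^ 2) / 2) (y / (1 + y ^ 2)) y := by
    have h : HasDerivAt (fun y : ℝ => 1 + y ^ 2) (2 * y) y := by
      simpa using ((hasDerivAt_id y).pow 2).const_add 1
    exact ((h.log (by positivity)).div_const 2).congr_deriv (by ring)
  rw [intervalIntegral.integral_eq_sub_of_hasDerivAt (fun y _ => hd y)
    (Continuous.intervalIntegrable (by fun_prop (disch := intros; positivity)) _ _)]
  have h1 : Real.log (1 + N ^ 2) ≤ Real.log (2 * N ^ 2) :=
    Real.log_le_log (by positivity) (by nlinarith)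
  rw [Real.log_mul (by norm_num) (by positivity), Real.log_pow] at h1
  simp
  push_cast at h1
  linarith

/-- Cutoff functions of arbitrarily small Dirichlet energy: the plane is parabolic. -/
theorem exists_logarithmic_cutoff (r : ℝ) {ε : ℝ} (hε : 0 < ε) :
    ∃ η : ℂ → ℝ, ContDiff ℝ 1 η ∧ HasCompactSupport η ∧ (∀ z, 0 ≤ η z) ∧ (∀ z, η z ≤ 1) ∧
      (∀ z, ‖z‖ ≤ r → η z = 1) ∧ ∫ z, ‖fderiv ℝ η z‖ ^ 2 ≤ ε := by
  obtain ⟨C, hC0, hC⟩ := exists_abs_deriv_smoothTransition_le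
  obtain ⟨R, hR1, hRr, hRε⟩ : ∃ R : ℝ, 1 ≤ R ∧ Real.log (1 + r ^ 2) ≤ R ∧
      16 * Real.pi * C ^ 2 / ε ≤ R :=
    ⟨max 1 (max (Real.log (1 + r ^ 2)) (16 * Real.pi * C ^ 2 / ε)), by simp, by simp, by simp⟩
  have hR : 0 < R := by linarith
  -- At least 1 for |z| ≤ r by the choice of R, and negative for |z| > e^R.
  set l : ℂ → ℝ := fun z => 2 - Real.log (1 + ‖z‖ ^ 2) / R with hl
  have hpos (z : ℂ) : 0 < 1 + ‖z‖ ^ 2 := by positivity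
  have hlc : ContDiff ℝ 1 l :=
    contDiff_const.sub (((contDiff_const.add (contDiff_norm_sq ℝ)).log
      fun z => (hpos z).ne').div_const R)
  have hS : ContDiff ℝ 1 Real.smoothTransition := Real.smoothTransition.contDiff
  set η : ℂ → ℝ := fun z => Real.smoothTransition (l z) with hη
  have hηc : ContDiff ℝ 1 η := hS.comp hlc
  have hlneg {z : ℂ} (hz : Real.exp R < ‖z‖) : l z < 0 := by
    have h1 : Real.exp (2 * R) < 1 + ‖z‖ ^ 2 := by
      rw [two_mul, Real.exp_add]
      nlinarith [Real.exp_pos R]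
    have h2 := (Real.lt_log_iff_exp_lt (hpos z)).2 h1
    have h3 : 2 < Real.log (1 + ‖z‖ ^ 2) / R := by rwa [lt_div_iff₀ hR]
    simp only [hl]; linarith
  have hη0 {z : ℂ} (hz : Real.exp R < ‖z‖) : η z = 0 :=
    Real.smoothTransition.zero_of_nonpos (hlneg hz).le
  have hsupp : HasCompactSupport η := by
    refine HasCompactSupport.intro (isCompact_closedBall (0 : ℂ) (Real.exp R)) fun z hz => ?_
    exact hη0 (by simpa using hz)
  -- Radial majorant of the energy density. Its integral is at most 2π · (4C²/R²) · 2R = 16πC²/R,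
  -- whence the third lower bound on R.
  set G : ℝ → ℝ := (Iic (Real.exp R)).indicator fun y => 4 * C ^ 2 / R ^ 2 * (1 + y ^ 2)⁻¹
  have hbound (z : ℂ) : ‖fderiv ℝ η z‖ ^ 2 ≤ G ‖z‖ := by
    rcases lt_or_ge (Real.exp R) ‖z‖ with hz | hz
    · have h0 : η =ᶠ[𝓝 z] fun _ => 0 := by
        filter_upwards [(isOpen_lt continuous_const continuous_norm).mem_nhds hz] with w hw
          using hη0 hw
      have : G ‖z‖ = 0 := indicator_of_notMem (by simpa using hz) _
      simp [h0.fderiv_eq, this]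
    · have hG : G ‖z‖ = 4 * C ^ 2 / R ^ 2 * (1 + ‖z‖ ^ 2)⁻¹ := indicator_of_mem (by simpa using hz) _
      have hSd := (hS.differentiable (by simp) (l z)).hasDerivAt
      have hld : HasFDerivAt l _ z :=
        ((((hasStrictFDerivAt_norm_sq z).hasFDerivAt.const_add 1).log
          (hpos z).ne').mul_const R⁻¹).const_sub 2
      have hηd : fderiv ℝ η z = _ := (hSd.comp_hasFDerivAt z hld).fderiv
      rw [hηd, norm_smul, norm_neg, norm_smul, norm_smul,
        ← Nat.cast_smul_eq_nsmul ℝ, norm_smul, innerSL_apply_norm, hG]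
      have hCz := hC (l z)
      rw [← Real.norm_eq_abs] at hCz
      have h1 : ‖R⁻¹‖ * (‖(1 + ‖z‖ ^ 2)⁻¹‖ * (‖((2 : ℕ) : ℝ)‖ * ‖z‖)) =
          R⁻¹ * ((1 + ‖z‖ ^ 2)⁻¹ * (2 * ‖z‖)) := by
        rw [Real.norm_of_nonneg (inv_nonneg.2 hR.le), Real.norm_of_nonneg (inv_nonneg.2 (hpos z).le)]
        simp
      rw [h1]
      calc _ ≤ (C * (R⁻¹ * ((1 + ‖z‖ ^ 2)⁻¹ * (2 * ‖z‖)))) ^ 2 := by gcongr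
        _ = 4 * C ^ 2 / R ^ 2 * ((1 + ‖z‖ ^ 2)⁻¹ * (‖z‖ ^ 2 * (1 + ‖z‖ ^ 2)⁻¹)) := by
          field_simp; ring
        _ ≤ 4 * C ^ 2 / R ^ 2 * ((1 + ‖z‖ ^ 2)⁻¹ * 1) := by
          gcongr
          rw [← div_eq_mul_inv, div_le_one (hpos z)]
          linarith
        _ = _ := by ring
  have hGint : ∫ z : ℂ, G ‖z‖ ≤ ε := by
    rw [integral_fun_norm_addHaar volume G]
    have h1 : ∫ y in Ioi (0 : ℝ), y ^ (Module.finrank ℝ ℂ - 1) • G y =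
        4 * C ^ 2 / R ^ 2 * ∫ y in (0 : ℝ)..Real.exp R, y / (1 + y ^ 2) := by
      rw [intervalIntegral.integral_of_le (Real.exp_pos R).le, ← integral_const_mul,
        ← Ioi_inter_Iic, ← setIntegral_indicator measurableSet_Iic]
      refine integral_congr_ae (Eventually.of_forall fun y => ?_)
      by_cases hy : y ∈ Iic (Real.exp R)
      · simp only [G, finrank_real_complex, indicator_of_mem hy, smul_eq_mul]
        ring
      · simp only [G, indicator_of_notMem hy, smul_zero]
    have h2 := integral_div_one_add_sq_le (Real.one_le_exp hR.le)
    rw [Real.log_exp] at h2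
    have h3 : ∫ y in (0 : ℝ)..Real.exp R, y / (1 + y ^ 2) ≤ 2 * R := by
      have := Real.log_two_lt_d9
      linarith
    rw [h1, finrank_real_complex, Measure.real, Complex.volume_ball]
    simp only [ENNReal.ofReal_one, one_pow, one_mul, ENNReal.coe_toReal, NNReal.coe_real_pi,
      nsmul_eq_mul, smul_eq_mul]
    calc _ ≤ ((2 : ℕ) : ℝ) * (Real.pi * (4 * C ^ 2 / R ^ 2 * (2 * R))) := by gcongr
      _ = 16 * Real.pi * C ^ 2 / R := by field_simp; norm_num; ring
      _ ≤ ε := by rwa [div_le_iff₀ hR, ← div_le_iff₀' hε]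
  have hGi : Integrable (fun z : ℂ => G ‖z‖) := by
    have hm : Measurable G := Measurable.indicator (by fun_prop) measurableSet_Iic
    have hon : IntegrableOn (fun z : ℂ => G ‖z‖) (Metric.closedBall (0 : ℂ) (Real.exp R)) := by
      refine Measure.integrableOn_of_bounded (M := 4 * C ^ 2 / R ^ 2) measure_closedBall_lt_top.ne
        (hm.comp measurable_norm).aestronglyMeasurable ?_
      refine Eventually.of_forall fun z => ?_
      refine (norm_indicator_le_norm_self (fun y => 4 * C ^ 2 / R ^ 2 * (1 + y ^ 2)⁻¹) ‖z‖).trans ?_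
      rw [Real.norm_of_nonneg (by positivity)]
      refine mul_le_of_le_one_right (by positivity) (inv_le_one_of_one_le₀ ?_)
      nlinarith [norm_nonneg z]
    refine hon.integrable_of_forall_notMem_eq_zero fun z hz => ?_
    exact indicator_of_notMem (by simpa using hz) _
  refine ⟨η, hηc, hsupp, fun z => Real.smoothTransition.nonneg _,
    fun z => Real.smoothTransition.le_one _, fun z hz => ?_, ?_⟩
  · refine Real.smoothTransition.one_of_one_le ?_
    have h1 : Real.log (1 + ‖z‖ ^ 2) ≤ R :=
      (Real.log_le_log (hpos z) (by gcongr)).trans hRr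
    have h2 : Real.log (1 + ‖z‖ ^ 2) / R ≤ 1 := by rwa [div_le_one hR]
    simp only [hl]; linarith
  · exact (integral_mono_of_nonneg (Eventually.of_forall fun z => by positivity) hGi
      (Eventually.of_forall hbound)).trans hGint

/-! ### Caccioppoli inequality and the quasiregular Liouville theorem. -/

theorem integral_mul_wirtinger {a b : ℂ → ℂ} (ha : ContDiff ℝ 1 a) (hb : ContDiff ℝ 1 b)
    (hbs : HasCompactSupport b) :
    ∫ z, a z * wirtingerZ b z = -∫ z, wirtingerZ a z * b z ∧
    ∫ z, a z * wirtingerZbar b z = -∫ z, wirtingerZbar a z * b z := by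
  have hca (v : ℂ) : Continuous fun z => fderiv ℝ a z v :=
    (ha.continuous_fderiv (by simp)).clm_apply continuous_const
  have hcb (v : ℂ) : Continuous fun z => fderiv ℝ b z v :=
    (hb.continuous_fderiv (by simp)).clm_apply continuous_const
  have i1 (v : ℂ) : Integrable fun z => fderiv ℝ a z v * b z :=
    ((hca v).mul hb.continuous).integrable_of_hasCompactSupport hbs.mul_left
  have i2 (v : ℂ) : Integrable fun z => a z * fderiv ℝ b z v :=
    (ha.continuous.mul (hcb v)).integrable_of_hasCompactSupport
      (HasCompactSupport.mul_left (hbs.fderiv_apply (𝕜 := ℝ) v))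
  have key (v : ℂ) : ∫ z, a z * fderiv ℝ b z v = -∫ z, fderiv ℝ a z v * b z :=
    integral_mul_fderiv_eq_neg_fderiv_mul_of_integrable (i1 v) (i2 v)
      ((ha.continuous.mul hb.continuous).integrable_of_hasCompactSupport hbs.mul_left)
      (fun z _ => ha.differentiable (by simp) z) (fun z _ => hb.differentiable (by simp) z)
  have e1 (c : ℂ) : ∫ z, (a z * fderiv ℝ b z 1 + c * (a z * fderiv ℝ b z I)) / 2 =
      -∫ z, (fderiv ℝ a z 1 * b z + c * (fderiv ℝ a z I * b z)) / 2 := by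
    rw [integral_div, integral_div, integral_add (i2 1) ((i2 I).const_mul c),
      integral_add (i1 1) ((i1 I).const_mul c), integral_const_mul, integral_const_mul, key, key]
    ring
  constructor
  · convert e1 (-I) using 4 <;> simp only [wirtingerZ] <;> ring
  · convert e1 I using 4 <;> simp only [wirtingerZbar] <;> ring

theorem norm_wirtinger_le (f : ℂ → ℂ) (z : ℂ) :
    ‖wirtingerZ f z‖ ≤ ‖fderiv ℝ f z‖ ∧ ‖wirtingerZbar f z‖ ≤ ‖fderiv ℝ f z‖ := by
  have h1 : ‖fderiv ℝ f z 1‖ ≤ ‖fderiv ℝ f z‖ := by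
    simpa using (fderiv ℝ f z).le_opNorm 1
  have hI : ‖I * fderiv ℝ f z I‖ ≤ ‖fderiv ℝ f z‖ := by
    simpa using (fderiv ℝ f z).le_opNorm I
  rw [wirtingerZ, wirtingerZbar, norm_div, norm_div, Complex.norm_two]
  constructor
  · linarith [norm_sub_le (fderiv ℝ f z 1) (I * fderiv ℝ f z I)]
  · linarith [norm_add_le (fderiv ℝ f z 1) (I * fderiv ℝ f z I)]

theorem HasCompactSupport.wirtinger {f : ℂ → ℂ} (hf : HasCompactSupport f) :
    HasCompactSupport (wirtingerZ f) ∧ HasCompactSupport (wirtingerZbar f) := by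
  constructor
  all_goals
    refine (hf.fderiv (𝕜 := ℝ)).mono fun z hz => ?_
    contrapose! hz
    simp [wirtingerZ, wirtingerZbar, Function.notMem_support.1 hz]

/-- The Jacobian is a divergence: after integration by parts the second-order terms cancel because
mixed derivatives commute. Only derivatives of the cutoff remain. -/
theorem integral_mul_jacobian {g χ : ℂ → ℂ} (hg : ContDiff ℝ 2 g) (hχ : ContDiff ℝ 1 χ)
    (hχs : HasCompactSupport χ) :
    ∫ z, χ z * ((‖wirtingerZ g z‖ ^ 2 - ‖wirtingerZbar g z‖ ^ 2 : ℝ) : ℂ) =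
      -∫ z, g z * (wirtingerZ χ z * conj (wirtingerZ g z) -
        wirtingerZbar χ z * conj (wirtingerZbar g z)) := by
  obtain ⟨hZ, hZb⟩ := contDiff_wirtinger (m := 1) hg (by norm_num)
  have hg1 : ContDiff ℝ 1 g := hg.of_le (by norm_num)
  have hcZ : ContDiff ℝ 1 fun z => conj (wirtingerZ g z) := conjCLE.contDiff.comp hZ
  have hcZb : ContDiff ℝ 1 fun z => conj (wirtingerZbar g z) := conjCLE.contDiff.comp hZb
  have hb := hχ.mul hcZ
  have hb' := hχ.mul hcZb
  have hbs : HasCompactSupport fun z => χ z * conj (wirtingerZ g z) := hχs.mul_right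
  have hbs' : HasCompactSupport fun z => χ z * conj (wirtingerZbar g z) := hχs.mul_right
  have e1 := (integral_mul_wirtinger hg1 hb hbs).1
  have e2 := (integral_mul_wirtinger hg1 hb' hbs').2
  have d1 : Continuous (wirtingerZ fun z => χ z * conj (wirtingerZ g z)) :=
    (contDiff_wirtinger (m := 0) hb (by norm_num)).1.continuous
  have d2 : Continuous (wirtingerZbar fun z => χ z * conj (wirtingerZbar g z)) :=
    (contDiff_wirtinger (m := 0) hb' (by norm_num)).2.continuous
  have s1 := (HasCompactSupport.wirtinger hbs).1
  have s2 := (HasCompactSupport.wirtinger hbs').2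
  have i1 : Integrable fun z => wirtingerZ g z * (χ z * conj (wirtingerZ g z)) :=
    (hZ.continuous.mul hb.continuous).integrable_of_hasCompactSupport hbs.mul_left
  have i2 : Integrable fun z => wirtingerZbar g z * (χ z * conj (wirtingerZbar g z)) :=
    (hZb.continuous.mul hb'.continuous).integrable_of_hasCompactSupport hbs'.mul_left
  have j1 : Integrable fun z => g z * wirtingerZ (fun z => χ z * conj (wirtingerZ g z)) z :=
    (hg.continuous.mul d1).integrable_of_hasCompactSupport s1.mul_left
  have j2 : Integrable fun z => g z * wirtingerZbar (fun z => χ z * conj (wirtingerZbar g z)) z :=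
    (hg.continuous.mul d2).integrable_of_hasCompactSupport s2.mul_left
  have lhs : ∫ z, χ z * ((‖wirtingerZ g z‖ ^ 2 - ‖wirtingerZbar g z‖ ^ 2 : ℝ) : ℂ) =
      (∫ z, wirtingerZ g z * (χ z * conj (wirtingerZ g z))) -
        ∫ z, wirtingerZbar g z * (χ z * conj (wirtingerZbar g z)) := by
    rw [← integral_sub i1 i2]
    refine integral_congr_ae (Eventually.of_forall fun z => ?_)
    simp only
    push_cast
    rw [← conj_mul', ← conj_mul']
    ring
  have rhs : ∫ z, g z * (wirtingerZ χ z * conj (wirtingerZ g z) -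
        wirtingerZbar χ z * conj (wirtingerZbar g z)) =
      (∫ z, g z * wirtingerZ (fun z => χ z * conj (wirtingerZ g z)) z) -
        ∫ z, g z * wirtingerZbar (fun z => χ z * conj (wirtingerZbar g z)) z := by
    rw [← integral_sub j1 j2]
    refine integral_congr_ae (Eventually.of_forall fun z => ?_)
    simp only
    have hχd := hχ.differentiable (by simp) z
    rw [(wirtinger_mul hχd (hcZ.differentiable (by simp) z)).1,
      (wirtinger_mul hχd (hcZb.differentiable (by simp) z)).2,
      (wirtinger_conj (hZ.differentiable (by simp) z)).1,
      (wirtinger_conj (hZb.differentiable (by simp) z)).2, wirtingerZ_wirtingerZbar_comm hg]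
    ring
  rw [lhs, rhs, e1, e2]
  ring

/-- Caccioppoli inequality for bounded `C²` maps with `|g_{z̄}| ≤ k |g_z|`. -/
theorem caccioppoli {g : ℂ → ℂ} {k M : ℝ} (hg : ContDiff ℝ 2 g) (hM : ∀ z, ‖g z‖ ≤ M)
    (hk0 : 0 ≤ k) (hk : k < 1) (hgk : ∀ z, ‖wirtingerZbar g z‖ ≤ k * ‖wirtingerZ g z‖)
    {η : ℂ → ℝ} (hη : ContDiff ℝ 1 η) (hηs : HasCompactSupport η) (hη0 : ∀ z, 0 ≤ η z) :
    (1 - k ^ 2) ^ 2 * ∫ z, η z ^ 2 * ‖wirtingerZ g z‖ ^ 2 ≤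
      16 * M ^ 2 * ∫ z, ‖fderiv ℝ η z‖ ^ 2 := by
  obtain ⟨hZ, hZb⟩ := contDiff_wirtinger (m := 1) hg (by norm_num)
  have hk2 : 0 < 1 - k ^ 2 := by nlinarith
  have hM0 : 0 ≤ M := (norm_nonneg _).trans (hM 0)
  -- The square leaves a factor η in the derivative of χ, so the cross term can be absorbed into the
  -- energy.
  set χ : ℂ → ℂ := fun z => ((η z : ℝ) : ℂ) ^ 2
  have hηC : ContDiff ℝ 1 fun z => ((η z : ℝ) : ℂ) := ofRealCLM.contDiff.comp hη
  have hχ : ContDiff ℝ 1 χ := hηC.pow 2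
  have hχs : HasCompactSupport χ := by
    refine hηs.mono fun z hz => ?_
    contrapose! hz
    simp [χ, Function.notMem_support.1 hz]
  have hχd (z : ℂ) : ‖fderiv ℝ χ z‖ ≤ 2 * η z * ‖fderiv ℝ η z‖ := by
    have h1 := (hη.differentiable (by simp) z).hasFDerivAt.pow 2
    have h2 : HasFDerivAt χ _ z :=
      (ofRealCLM.hasFDerivAt.comp z h1).congr_of_eventuallyEq
        (Eventually.of_forall fun w => by simp [χ])
    rw [h2.fderiv]
    refine (ContinuousLinearMap.opNorm_comp_le _ _).trans ?_
    rw [norm_smul, ofRealCLM_norm, one_mul]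
    gcongr
    simp [abs_of_nonneg (hη0 z)]
  have hid := integral_mul_jacobian hg hχ hχs
  have iE : Integrable fun z => η z ^ 2 * ‖wirtingerZ g z‖ ^ 2 := by
    refine Continuous.integrable_of_hasCompactSupport ((hη.continuous.pow 2).mul
      (hZ.continuous.norm.pow 2)) (hηs.mono fun z hz => ?_)
    contrapose! hz
    simp [Function.notMem_support.1 hz]
  have iJ : Integrable fun z => η z ^ 2 * (‖wirtingerZ g z‖ ^ 2 - ‖wirtingerZbar g z‖ ^ 2) := by
    refine Continuous.integrable_of_hasCompactSupport ((hη.continuous.pow 2).mul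
      ((hZ.continuous.norm.pow 2).sub (hZb.continuous.norm.pow 2))) (hηs.mono fun z hz => ?_)
    contrapose! hz
    simp [Function.notMem_support.1 hz]
  have iD : Integrable fun z => ‖fderiv ℝ η z‖ ^ 2 := by
    refine Continuous.integrable_of_hasCompactSupport
      ((hη.continuous_fderiv (by simp)).norm.pow 2) ((hηs.fderiv (𝕜 := ℝ)).mono fun z hz => ?_)
    contrapose! hz
    simp [Function.notMem_support.1 hz]
  have hJ : (1 - k ^ 2) * ∫ z, η z ^ 2 * ‖wirtingerZ g z‖ ^ 2 ≤
      ∫ z, η z ^ 2 * (‖wirtingerZ g z‖ ^ 2 - ‖wirtingerZbar g z‖ ^ 2) := by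
    rw [← integral_const_mul]
    refine integral_mono (iE.const_mul _) iJ fun z => ?_
    have h1 : ‖wirtingerZbar g z‖ ^ 2 ≤ k ^ 2 * ‖wirtingerZ g z‖ ^ 2 := by
      rw [← mul_pow]
      exact pow_le_pow_left₀ (norm_nonneg _) (hgk z) 2
    calc _ = η z ^ 2 * (‖wirtingerZ g z‖ ^ 2 - k ^ 2 * ‖wirtingerZ g z‖ ^ 2) := by ring
      _ ≤ _ := by gcongr
  have hnorm : ∫ z, η z ^ 2 * (‖wirtingerZ g z‖ ^ 2 - ‖wirtingerZbar g z‖ ^ 2) ≤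
      ‖∫ z, χ z * ((‖wirtingerZ g z‖ ^ 2 - ‖wirtingerZbar g z‖ ^ 2 : ℝ) : ℂ)‖ := by
    have : ∫ z, χ z * ((‖wirtingerZ g z‖ ^ 2 - ‖wirtingerZbar g z‖ ^ 2 : ℝ) : ℂ) =
        ((∫ z, η z ^ 2 * (‖wirtingerZ g z‖ ^ 2 - ‖wirtingerZbar g z‖ ^ 2) : ℝ) : ℂ) := by
      rw [← integral_complex_ofReal]
      refine integral_congr_ae (Eventually.of_forall fun z => ?_)
      simp [χ]
    rw [this, Complex.norm_real]
    exact Real.le_norm_self _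
  have hpt (z : ℂ) : ‖g z * (wirtingerZ χ z * conj (wirtingerZ g z) -
        wirtingerZbar χ z * conj (wirtingerZbar g z))‖ ≤
      (1 - k ^ 2) / 2 * (η z ^ 2 * ‖wirtingerZ g z‖ ^ 2) +
        8 * M ^ 2 / (1 - k ^ 2) * ‖fderiv ℝ η z‖ ^ 2 := by
    obtain ⟨n1, n2⟩ := norm_wirtinger_le χ z
    have hb : ‖wirtingerZbar g z‖ ≤ ‖wirtingerZ g z‖ :=
      (hgk z).trans (mul_le_of_le_one_left (norm_nonneg _) hk.le)
    have hη' := hη0 z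
    calc _ ≤ M * (‖fderiv ℝ χ z‖ * ‖wirtingerZ g z‖ + ‖fderiv ℝ χ z‖ * ‖wirtingerZ g z‖) := by
          rw [norm_mul]
          gcongr
          · exact hM z
          · refine (norm_sub_le _ _).trans ?_
            rw [norm_mul, norm_mul, RCLike.norm_conj, RCLike.norm_conj]
            gcongr
      _ ≤ M * (2 * η z * ‖fderiv ℝ η z‖ * ‖wirtingerZ g z‖ +
          2 * η z * ‖fderiv ℝ η z‖ * ‖wirtingerZ g z‖) := by
          gcongr <;> exact hχd z
      _ ≤ _ := by
          -- Weighted Young inequality. The weight (1 - k²)/2 is half of the coefficient in `hJ`, so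
          -- the energy on the right can be absorbed.
          have h := sq_nonneg ((1 - k ^ 2) * (η z * ‖wirtingerZ g z‖) - 4 * M * ‖fderiv ℝ η z‖)
          rw [← sub_nonneg]
          have : (1 - k ^ 2) / 2 * (η z ^ 2 * ‖wirtingerZ g z‖ ^ 2) +
              8 * M ^ 2 / (1 - k ^ 2) * ‖fderiv ℝ η z‖ ^ 2 -
              M * (2 * η z * ‖fderiv ℝ η z‖ * ‖wirtingerZ g z‖ +
                2 * η z * ‖fderiv ℝ η z‖ * ‖wirtingerZ g z‖) =
              ((1 - k ^ 2) * (η z * ‖wirtingerZ g z‖) - 4 * M * ‖fderiv ℝ η z‖) ^ 2 /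
                (2 * (1 - k ^ 2)) := by
            field_simp
            ring
          rw [this]
          positivity
  have hfin := norm_integral_le_of_norm_le
    ((iE.const_mul ((1 - k ^ 2) / 2)).add (iD.const_mul (8 * M ^ 2 / (1 - k ^ 2))))
    (Eventually.of_forall hpt)
  have hsum : ∫ z, ((1 - k ^ 2) / 2 * (η z ^ 2 * ‖wirtingerZ g z‖ ^ 2) +
        8 * M ^ 2 / (1 - k ^ 2) * ‖fderiv ℝ η z‖ ^ 2) =
      (1 - k ^ 2) / 2 * (∫ z, η z ^ 2 * ‖wirtingerZ g z‖ ^ 2) +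
        8 * M ^ 2 / (1 - k ^ 2) * ∫ z, ‖fderiv ℝ η z‖ ^ 2 := by
    rw [integral_add (iE.const_mul _) (iD.const_mul _), integral_const_mul, integral_const_mul]
  have hall := ((hJ.trans hnorm).trans ((congrArg norm hid).trans (norm_neg _)).le).trans
    (hfin.trans_eq hsum)
  set X := ∫ z, η z ^ 2 * ‖wirtingerZ g z‖ ^ 2
  set Y := ∫ z, ‖fderiv ℝ η z‖ ^ 2
  have h2 : (1 - k ^ 2) / 2 * X ≤ 8 * M ^ 2 / (1 - k ^ 2) * Y := by linarith
  calc _ = 2 * (1 - k ^ 2) * ((1 - k ^ 2) / 2 * X) := by ring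
    _ ≤ 2 * (1 - k ^ 2) * (8 * M ^ 2 / (1 - k ^ 2) * Y) := by gcongr
    _ = _ := by field_simp; norm_num; ring

/-- Liouville theorem for `C²` quasiregular maps. -/
theorem wirtingerZ_eq_zero_of_bounded {g : ℂ → ℂ} {k M : ℝ} (hg : ContDiff ℝ 2 g)
    (hM : ∀ z, ‖g z‖ ≤ M) (hk0 : 0 ≤ k) (hk : k < 1)
    (hgk : ∀ z, ‖wirtingerZbar g z‖ ≤ k * ‖wirtingerZ g z‖) (z₀ : ℂ) : wirtingerZ g z₀ = 0 := by
  by_contra hne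
  have hk2 : 0 < 1 - k ^ 2 := by nlinarith
  have hZc : Continuous (wirtingerZ g) := (contDiff_wirtinger (m := 1) hg (by norm_num)).1.continuous
  have hcont {η : ℂ → ℝ} (hη : ContDiff ℝ 1 η) :
      Continuous fun z => η z ^ 2 * ‖wirtingerZ g z‖ ^ 2 :=
    (hη.continuous.pow 2).mul (hZc.norm.pow 2)
  have hsup {η : ℂ → ℝ} (hη : HasCompactSupport η) :
      HasCompactSupport fun z => η z ^ 2 * ‖wirtingerZ g z‖ ^ 2 := by
    refine hη.mono fun z hz => ?_
    contrapose! hz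
    simp [Function.notMem_support.1 hz]
  obtain ⟨η₀, hη₀, hη₀s, hη₀0, hη₀1, hη₀r, -⟩ := exists_logarithmic_cutoff ‖z₀‖ one_pos
  have hpos : 0 < ∫ z, η₀ z ^ 2 * ‖wirtingerZ g z‖ ^ 2 := by
    refine (hcont hη₀).integral_pos_of_hasCompactSupport_nonneg_nonzero (x := z₀) (hsup hη₀s)
      (fun z => by positivity) ?_
    rw [hη₀r z₀ le_rfl]
    simpa using hne
  set X := ∫ z, η₀ z ^ 2 * ‖wirtingerZ g z‖ ^ 2
  obtain ⟨r, hr⟩ := hη₀s.isCompact.isBounded.exists_norm_le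
  -- Chosen so that Caccioppoli with cutoff energy at most half of this bounds X by X/2. The +1
  -- covers M = 0.
  have hε : 0 < (1 - k ^ 2) ^ 2 * X / (16 * M ^ 2 + 1) := by positivity
  obtain ⟨η, hη, hηs, hη0, hη1, hηr, hηε⟩ := exists_logarithmic_cutoff r (half_pos hε)
  have hle : X ≤ ∫ z, η z ^ 2 * ‖wirtingerZ g z‖ ^ 2 := by
    refine integral_mono ((hcont hη₀).integrable_of_hasCompactSupport (hsup hη₀s))
      ((hcont hη).integrable_of_hasCompactSupport (hsup hηs)) fun z => ?_
    by_cases hz : z ∈ tsupport η₀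
    · have := hηr z (hr z hz)
      simp only
      rw [this]
      have := hη₀0 z
      gcongr
      · exact hη₀1 z
    · simp only [image_eq_zero_of_notMem_tsupport hz]
      rw [zero_pow two_ne_zero, zero_mul]
      positivity
  have hc := caccioppoli hg hM hk0 hk hgk hη hηs hη0
  have h1 : (1 - k ^ 2) ^ 2 * X ≤ 16 * M ^ 2 * ((1 - k ^ 2) ^ 2 * X / (16 * M ^ 2 + 1) / 2) :=
    calc _ ≤ _ := by gcongr
      _ ≤ _ := hc
      _ ≤ _ := by gcongr
  have h2 : 16 * M ^ 2 * ((1 - k ^ 2) ^ 2 * X / (16 * M ^ 2 + 1) / 2) ≤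
      (1 - k ^ 2) ^ 2 * X / 2 := by
    rw [show 16 * M ^ 2 * ((1 - k ^ 2) ^ 2 * X / (16 * M ^ 2 + 1) / 2) =
      (16 * M ^ 2 / (16 * M ^ 2 + 1)) * ((1 - k ^ 2) ^ 2 * X / 2) by ring]
    refine mul_le_of_le_one_left (by positivity) ?_
    rw [div_le_one (by positivity)]
    linarith
  have h3 : 0 < (1 - k ^ 2) ^ 2 * X := by positivity
  linarith

/-! ### Holomorphic data of the tension equation and constancy of |μ|. -/

/-- An entire function dominated by another one is a constant multiple of it. -/
theorem exists_eq_const_mul_of_norm_le {A B : ℂ → ℂ} (hA : Differentiable ℂ A)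
    (hB : Differentiable ℂ B) (hAB : ∀ z, ‖B z‖ ≤ ‖A z‖) {z₁ : ℂ} (hz₁ : A z₁ ≠ 0) :
    ∃ c, ∀ z, B z = c * A z := by
  set q : ℂ → ℂ := fun z => B z / A z with hq
  have hq1 (z : ℂ) : ‖q z‖ ≤ 1 := by
    rw [hq, norm_div]
    exact div_le_one_of_le₀ (hAB z) (norm_nonneg _)
  have hne (z : ℂ) : ∀ᶠ w in 𝓝[≠] z, A w ≠ 0 := by
    rcases (hA.analyticAt z).eventually_eq_zero_or_eventually_ne_zero with h | h
    · have := AnalyticOnNhd.eq_of_eventuallyEq (f := A) (g := 0) (fun w _ => hA.analyticAt w)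
        (fun w _ => analyticAt_const) h
      exact absurd (congrFun this z₁) hz₁
    · exact h
  have hqd {z : ℂ} (hz : A z ≠ 0) : DifferentiableAt ℂ q z := (hB z).div (hA z) hz
  -- The bounded quotient has removable singularities at the isolated zeros of A. Taking limits at
  -- every point gives one globally defined extension, to which Liouville applies.
  set Q : ℂ → ℂ := fun z => limUnder (𝓝[≠] z) q with hQ
  have hQq {z : ℂ} (hz : A z ≠ 0) : Q z = q z :=
    ((hqd hz).continuousAt.tendsto.mono_left nhdsWithin_le_nhds).limUnder_eq
  have hQd (z : ℂ) : DifferentiableAt ℂ Q z := by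
    obtain ⟨r, hr, hball⟩ := Metric.mem_nhdsWithin_iff.1 (hne z)
    have hs : Metric.ball z r ∈ 𝓝 z := Metric.ball_mem_nhds z hr
    have hsub {w : ℂ} (hw : w ∈ Metric.ball z r \ {z}) : A w ≠ 0 := hball ⟨hw.1, hw.2⟩
    have hup := differentiableOn_update_limUnder_of_bddAbove (f := q) hs
      (fun w hw => (hqd (hsub hw)).differentiableWithinAt)
      ⟨1, by rintro _ ⟨w, -, rfl⟩; exact hq1 w⟩
    refine (hup.differentiableAt hs).congr_of_eventuallyEq ?_
    filter_upwards [hs] with w hw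
    by_cases hwz : w = z
    · rw [hwz, Function.update_self]
    · rw [Function.update_of_ne hwz, hQq (hsub ⟨hw, hwz⟩)]
  have hQ1 (z : ℂ) : ‖Q z‖ ≤ 1 := by
    refine le_of_tendsto ((hQd z).continuousAt.norm.tendsto.mono_left
      (nhdsWithin_le_nhds (s := {z}ᶜ))) ?_
    filter_upwards [hne z] with w hw
    rw [hQq hw]
    exact hq1 w
  have hbdd : Bornology.IsBounded (range Q) :=
    isBounded_iff_forall_norm_le.2 ⟨1, by rintro _ ⟨z, rfl⟩; exact hQ1 z⟩
  refine ⟨Q 0, fun z => ?_⟩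
  by_cases hz : A z = 0
  · have := hAB z
    rw [hz, norm_zero, norm_le_zero_iff] at this
    rw [this, hz, mul_zero]
  · have hQd' : Differentiable ℂ Q := hQd
    rw [hQd'.apply_eq_apply_of_bounded hbdd 0 z, hQq hz, hq, div_mul_cancel₀ _ hz]

/-- Zero curvature makes log ρ harmonic, and the ∂-derivative of a harmonic function is holomorphic.
-/
theorem differentiableOn_logDensityZ {ρ : ℂ → ℝ} {V : Set ℂ} (hV : IsOpen V)
    (hρ : IsConformalMetricOn ρ V) (hflat : IsFlatOn ρ V) :
    DifferentiableOn ℂ (logDensityZ ρ) V := by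
  intro w hw
  have hsm {x : ℂ} (hx : x ∈ V) : ContDiffAt ℝ 2 (fun x => Real.log (ρ x)) x :=
    ((hρ.smooth.contDiffAt (hV.mem_nhds hx)).of_le (by norm_cast)).log
      (hρ.pos x hx).ne'
  have hharm : InnerProductSpace.HarmonicAt (fun x => Real.log (ρ x)) w := by
    refine ⟨hsm hw, ?_⟩
    filter_upwards [hV.mem_nhds hw] with x hx
    have := hflat x hx
    rw [gaussianCurvature, mul_eq_zero, neg_eq_zero, inv_eq_zero] at this
    exact this.resolve_left (pow_ne_zero 2 (hρ.pos x hx).ne')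
  refine (((HarmonicAt.differentiableAt_complex_partial hharm).div_const 2).congr_of_eventuallyEq
    ?_).differentiableWithinAt
  filter_upwards [hV.mem_nhds hw] with x hx
  have h : HasFDerivAt (fun x => ((Real.log (ρ x) : ℝ) : ℂ)) _ x :=
    ofRealCLM.hasFDerivAt.comp x ((hsm hx).differentiableAt (by simp)).hasFDerivAt
  rw [logDensityZ, wirtingerZ, h.fderiv]
  rfl

/-- A solution of the tension equation with holomorphic coefficient `p` becomes, after multiplication
of its Wirtinger derivatives by `exp h`, a pair of an entire and an anti-entire function. -/
theorem exists_integrating_factor {f p : ℂ → ℂ} {V : Set ℂ} (hf : ContDiff ℝ 2 f)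
    (hV : IsOpen V) (hfV : ∀ z, f z ∈ V) (hp : DifferentiableOn ℂ p V)
    (ht : ∀ z, wirtingerZbar (wirtingerZ f) z + p (f z) * wirtingerZ f z * wirtingerZbar f z = 0) :
    ∃ h : ℂ → ℂ, (∀ z, HasFDerivAt h (p (f z) • fderiv ℝ f z) z) ∧
      Differentiable ℂ (fun z => exp (h z) * wirtingerZ f z) ∧
      Differentiable ℂ (fun z => conj (exp (h z) * wirtingerZbar f z)) := by
  obtain ⟨h, hh2, hh⟩ := exists_pullback_primitive hf hV hfV hp
  obtain ⟨hZ, hZb⟩ := contDiff_wirtinger (m := 1) hf (by norm_num)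
  have hhd (z : ℂ) : DifferentiableAt ℝ h z := (hh z).differentiableAt
  have hhw (z : ℂ) := wirtinger_of_hasFDerivAt (a := p (f z) * wirtingerZ f z)
    (b := p (f z) * wirtingerZbar f z) (hh z) (fun v => by
      simp [fderiv_apply_eq_wirtinger]; ring)
  have hew (z : ℂ) := wirtinger_comp (Complex.hasDerivAt_exp (h z)) (hhd z)
  have hed (z : ℂ) : DifferentiableAt ℝ (fun z => exp (h z)) z :=
    (HasFDerivAt.of_comp_holomorphic (Complex.hasDerivAt_exp (h z)) (hhd z)).differentiableAt
  have hZd (z : ℂ) := hZ.differentiable (by simp) z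
  have hZbd (z : ℂ) := hZb.differentiable (by simp) z
  refine ⟨h, hh, fun z => ?_, fun z => ?_⟩
  -- The z̄-derivative of e^h f_z is e^h times the tension. In the second case conjugation turns the
  -- z-derivative of e^h f_z̄ into the z̄-derivative, with the same factor.
  · refine (differentiableAt_of_wirtingerZbar_eq_zero ((hed z).mul (hZd z)) ?_).differentiableAt
    erw [(wirtinger_mul (hed z) (hZd z)).2]
    rw [(hew z).2, (hhw z).2]
    linear_combination exp (h z) * ht z
  · have hd : DifferentiableAt ℝ (fun z => exp (h z) * wirtingerZbar f z) z := (hed z).mul (hZbd z)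
    refine (differentiableAt_of_wirtingerZbar_eq_zero
      (conjCLE.differentiableAt.comp z hd) ?_).differentiableAt
    erw [(wirtinger_conj hd).2]
    rw [(wirtinger_mul (hed z) (hZbd z)).1, (hew z).1, (hhw z).1, wirtingerZ_wirtingerZbar_comm hf,
      map_eq_zero]
    linear_combination exp (h z) * ht z

/-- Since φ''/φ' = p, the coordinate φ turns the tension equation into the Laplace equation for φ ∘
f. The free value b lets P ∘ f match the global primitive h. -/
theorem exists_developing_map {p : ℂ → ℂ} {V : Set ℂ} {w₀ b : ℂ} (hV : V ∈ 𝓝 w₀)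
    (hp : DifferentiableOn ℂ p V) :
    ∃ r > 0, ∃ P φ : ℂ → ℂ, P w₀ = b ∧ InjOn φ (Metric.ball w₀ r) ∧
      ∀ w ∈ Metric.ball w₀ r, HasDerivAt P (p w) w ∧ HasDerivAt φ (exp (P w)) w := by
  obtain ⟨r, hr, hrV⟩ := Metric.mem_nhds_iff.1 hV
  obtain ⟨P, hP0, hP⟩ := (hp.mono hrV).isExactOn_ball.with_val_at w₀ b
  have hexp : DifferentiableOn ℂ (fun w => exp (P w)) (Metric.ball w₀ r) := fun w hw =>
    (hP w hw).differentiableAt.cexp.differentiableWithinAt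
  obtain ⟨φ, hφ⟩ := hexp.isExactOn_ball
  have hφa : AnalyticAt ℂ φ w₀ :=
    DifferentiableOn.analyticAt (fun w hw => (hφ w hw).differentiableAt.differentiableWithinAt)
      (Metric.ball_mem_nhds w₀ hr)
  have hφs : HasStrictDerivAt φ (exp (P w₀)) w₀ := by
    have := hφa.hasStrictDerivAt
    rwa [(hφ w₀ (Metric.mem_ball_self hr)).deriv] at this
  have hinv := (hφs.hasStrictFDerivAt_equiv (exp_ne_zero _)).eventually_left_inverse
  obtain ⟨s, hs, hsinv⟩ := Metric.eventually_nhds_iff_ball.1 hinv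
  refine ⟨min r s, lt_min hr hs, P, φ, hP0, ?_, fun w hw => ?_⟩
  · intro x hx y hy hxy
    rw [← hsinv x (Metric.ball_subset_ball (min_le_right _ _) hx), hxy,
      hsinv y (Metric.ball_subset_ball (min_le_right _ _) hy)]
  · have hw' := Metric.ball_subset_ball (min_le_left r s) hw
    exact ⟨hP w hw', hφ w hw'⟩

/-- Near z₀ the map φ ∘ f is a function of H alone, up to a constant, where H' = e^h f_z. So H
inherits injectivity, and its derivative cannot vanish. -/
theorem wirtingerZ_ne_zero_of_injective {f p h : ℂ → ℂ} {V : Set ℂ} {c : ℂ} (hf : ContDiff ℝ 2 f)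
    (hV : IsOpen V) (hfV : ∀ z, f z ∈ V) (hinj : Function.Injective f)
    (hp : DifferentiableOn ℂ p V) (hh : ∀ z, HasFDerivAt h (p (f z) • fderiv ℝ f z) z)
    (hA : Differentiable ℂ (fun z => exp (h z) * wirtingerZ f z))
    (hc : ∀ z, conj (exp (h z) * wirtingerZbar f z) = c * (exp (h z) * wirtingerZ f z)) (z₀ : ℂ) :
    wirtingerZ f z₀ ≠ 0 := by
  obtain ⟨r, hr, P, φ, hP0, hφinj, hPφ⟩ :=
    exists_developing_map (b := h z₀) (hV.mem_nhds (hfV z₀)) hp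
  obtain ⟨s, hs, hsr⟩ := Metric.continuousAt_iff.1 hf.continuous.continuousAt r hr
  set U := Metric.ball z₀ s
  have hUf {z : ℂ} (hz : z ∈ U) : f z ∈ Metric.ball (f z₀) r := hsr hz
  have hUpre : IsPreconnected U := (convex_ball z₀ s).isPreconnected
  have hfd (z : ℂ) : DifferentiableAt ℝ f z := hf.differentiable (by simp) z
  have hPf {z : ℂ} (hz : z ∈ U) : HasFDerivAt (fun z => P (f z)) (p (f z) • fderiv ℝ f z) z :=
    HasFDerivAt.of_comp_holomorphic (hPφ _ (hUf hz)).1 (hfd z)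
  have hPh : EqOn (fun z => P (f z)) h U :=
    Metric.isOpen_ball.eqOn_of_fderiv_eq (𝕜 := ℝ) hUpre
      (fun z hz => (hPf hz).differentiableAt.differentiableWithinAt)
      (fun z _ => (hh z).differentiableAt.differentiableWithinAt)
      (fun z hz => by rw [(hPf hz).fderiv, (hh z).fderiv]) (Metric.mem_ball_self hs) hP0
  obtain ⟨H, hH⟩ := hA.isExactOn_univ
  have hφf {z : ℂ} (hz : z ∈ U) :
      HasFDerivAt (fun z => φ (f z)) (exp (h z) • fderiv ℝ f z) z := by
    rw [← hPh hz]
    exact HasFDerivAt.of_comp_holomorphic (hPφ _ (hUf hz)).2 (hfd z)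
  have hHd (z : ℂ) : HasFDerivAt (fun z => H z + conj (c * H z)) (exp (h z) • fderiv ℝ f z) z := by
    have h1 := (hH z (mem_univ z)).complexToReal_fderiv
    have h2 := ((hH z (mem_univ z)).const_mul c).complexToReal_fderiv
    refine (h1.add (conjCLE.hasFDerivAt.comp z h2)).congr_fderiv ?_
    refine ContinuousLinearMap.ext fun v => ?_
    have hc' : exp (h z) * wirtingerZbar f z = conj (c * (exp (h z) * wirtingerZ f z)) := by
      rw [← hc, conj_conj]
    simp only [map_mul] at hc'
    simp [fderiv_apply_eq_wirtinger]
    linear_combination -conj v * hc'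
  obtain ⟨K, hK⟩ := Metric.isOpen_ball.exists_eq_add_of_fderiv_eq (𝕜 := ℝ) hUpre
    (fun z hz => (hφf hz).differentiableAt.differentiableWithinAt)
    (fun z _ => (hHd z).differentiableAt.differentiableWithinAt)
    (fun z hz => by rw [(hφf hz).fderiv, (hHd z).fderiv])
  have hHinj : InjOn H U := by
    intro x hx y hy hxy
    have h1 : φ (f x) = φ (f y) := by
      have hx' := hK hx
      have hy' := hK hy
      simp only at hx' hy'
      rw [hx', hy', hxy]
    exact hinj (hφinj (hUf hx) (hUf hy) h1)
  have hHa : AnalyticAt ℂ H z₀ :=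
    Differentiable.analyticAt (fun z => (hH z (mem_univ z)).differentiableAt) z₀
  have := AnalyticAt.deriv_ne_zero_of_injOn hHa (Metric.ball_mem_nhds z₀ hs) hHinj
  rw [(hH z₀ (mem_univ z₀)).deriv] at this
  exact right_ne_zero_of_mul this

theorem exists_norm_wirtingerZbar_eq {f p : ℂ → ℂ} {V : Set ℂ} (hf : ContDiff ℝ 2 f)
    (hV : IsOpen V) (hinj : Function.Injective f) (hrange : range f = V)
    (horient : ∀ z, 0 ≤ jacobian f z) (hp : DifferentiableOn ℂ p V)
    (ht : ∀ z, wirtingerZbar (wirtingerZ f) z + p (f z) * wirtingerZ f z * wirtingerZbar f z = 0) :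
    ∃ k : ℝ, 0 ≤ k ∧ k < 1 ∧
      ∀ z, wirtingerZ f z ≠ 0 ∧ ‖wirtingerZbar f z‖ = k * ‖wirtingerZ f z‖ := by
  have hfV (z : ℂ) : f z ∈ V := hrange ▸ mem_range_self z
  obtain ⟨h, hh, hA, hB⟩ := exists_integrating_factor hf hV hfV hp ht
  have hle (z : ℂ) : ‖wirtingerZbar f z‖ ≤ ‖wirtingerZ f z‖ := by
    have := horient z
    rw [jacobian_eq, sub_nonneg] at this
    exact (pow_le_pow_iff_left₀ (norm_nonneg _) (norm_nonneg _) two_ne_zero).1 this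
  -- Sard: otherwise the nonempty open set V would be null.
  obtain ⟨z₁, hz₁⟩ : ∃ z, jacobian f z ≠ 0 := by
    by_contra! hzero
    have h0 := addHaar_image_eq_zero_of_det_fderivWithin_eq_zero volume (s := univ)
      (fun z _ => (hf.differentiable (by simp) z).hasFDerivAt.hasFDerivWithinAt)
      (fun z _ => hzero z)
    rw [image_univ, hrange] at h0
    exact (hV.measure_pos volume ⟨f 0, hfV 0⟩).ne' h0
  have hlt : ‖wirtingerZbar f z₁‖ < ‖wirtingerZ f z₁‖ := by
    refine lt_of_le_of_ne (hle z₁) fun heq => hz₁ ?_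
    rw [jacobian_eq, heq, sub_self]
  have hA₁ : exp (h z₁) * wirtingerZ f z₁ ≠ 0 :=
    mul_ne_zero (exp_ne_zero _) (norm_pos_iff.1 ((norm_nonneg _).trans_lt hlt))
  obtain ⟨c, hc⟩ := exists_eq_const_mul_of_norm_le hA hB (fun z => by
    rw [RCLike.norm_conj, norm_mul, norm_mul]
    gcongr
    exact hle z) hA₁
  have hcn (z : ℂ) : ‖wirtingerZbar f z‖ = ‖c‖ * ‖wirtingerZ f z‖ := by
    have := congrArg norm (hc z)
    rw [RCLike.norm_conj, norm_mul, norm_mul, norm_mul] at this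
    have he : ‖exp (h z)‖ ≠ 0 := norm_ne_zero_iff.2 (exp_ne_zero _)
    exact mul_left_cancel₀ he (by linear_combination this)
  refine ⟨‖c‖, norm_nonneg c, ?_, fun z =>
    ⟨wirtingerZ_ne_zero_of_injective hf hV hfV hinj hp hh hA hc z, hcn z⟩⟩
  rw [hcn] at hlt
  by_contra! hc1
  exact absurd hlt (not_lt.2 (le_mul_of_one_le_left (norm_nonneg _) hc1))

/-! ### Surjectivity, quasiconformality and the conclusion. -/

theorem exists_smooth_log {f : ℂ → ℂ} {w₀ : ℂ} (hf : ContDiff ℝ 2 f) (hw₀ : ∀ z, f z ≠ w₀) :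
    ∃ L : ℂ → ℂ, ContDiff ℝ 2 L ∧ (∀ z, exp (L z) = f z - w₀) ∧
      ∀ z, HasFDerivAt L ((f z - w₀)⁻¹ • fderiv ℝ f z) z := by
  have hp : DifferentiableOn ℂ (fun w : ℂ => (w - w₀)⁻¹) {w₀}ᶜ := fun w hw =>
    ((differentiableAt_id.sub_const w₀).inv (sub_ne_zero.2 hw)).differentiableWithinAt
  obtain ⟨L, hL2, hL⟩ := exists_pullback_primitive hf isOpen_compl_singleton hw₀ hp
  have hconst (z : ℂ) : HasFDerivAt (fun z => exp (-L z) * (f z - w₀)) (0 : ℂ →L[ℝ] ℂ) z := by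
    have h1 := HasFDerivAt.of_comp_holomorphic (p := fun w => exp (-w))
      ((hasDerivAt_id (L z)).neg.cexp) (hL z).differentiableAt
    have h2 := (hf.differentiable (by simp) z).hasFDerivAt.sub_const w₀
    refine (h1.mul h2).congr_fderiv (ContinuousLinearMap.ext fun v => ?_)
    have := sub_ne_zero.2 (hw₀ z)
    simp [(hL z).fderiv]
    field_simp
    ring
  have hc (z : ℂ) : exp (-L z) * (f z - w₀) = exp (-L 0) * (f 0 - w₀) :=
    is_const_of_fderiv_eq_zero (𝕜 := ℝ) (fun z => (hconst z).differentiableAt)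
      (fun z => (hconst z).fderiv) z 0
  have hne : exp (-L 0) * (f 0 - w₀) ≠ 0 := mul_ne_zero (exp_ne_zero _) (sub_ne_zero.2 (hw₀ 0))
  -- A primitive of df/(f - w₀) is a logarithm only up to an additive constant, corrected here.
  refine ⟨fun z => L z + log (exp (-L 0) * (f 0 - w₀)), hL2.add contDiff_const, fun z => ?_,
    fun z => (hL z).add_const _⟩
  rw [exp_add, exp_log hne, ← hc z, ← mul_assoc, ← exp_add, add_neg_cancel, exp_zero, one_mul]

/-- A `C²` quasiconformal embedding of the plane into itself is onto. -/
theorem surjective_of_norm_wirtingerZbar_le {f : ℂ → ℂ} {k : ℝ} (hf : ContDiff ℝ 2 f)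
    (hind : IsInducing f) (hk0 : 0 ≤ k) (hk : k < 1)
    (hfk : ∀ z, ‖wirtingerZbar f z‖ ≤ k * ‖wirtingerZ f z‖) (hZ : wirtingerZ f 0 ≠ 0) :
    Function.Surjective f := by
  intro w₀
  by_contra! hw₀
  obtain ⟨L, hL2, hexp, hL⟩ := exists_smooth_log hf hw₀
  set S : ℂ → ℂ := fun z => exp (L z / 2) with hS
  have hS2 (z : ℂ) : S z ^ 2 = f z - w₀ := by
    rw [← hexp, hS, ← exp_nat_mul]
    congr 1
    push_cast
    ring
  have hScont : Continuous S := (hL2.continuous.div_const 2).cexp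
  set a := S 0 with ha
  have ha0 : a ≠ 0 := exp_ne_zero _
  -- If S z is near -a, then f z = S z ^ 2 + w₀ is near f 0, so z is near 0 because f is inducing.
  -- Then S z is near a as well, which is impossible.
  obtain ⟨ε, hε, hlow⟩ : ∃ ε > 0, ∀ z, ε ≤ ‖S z + a‖ := by
    have h1 : ∀ᶠ z in 𝓝 (0 : ℂ), ‖S z - a‖ < ‖a‖ := by
      have : ContinuousAt (fun z => ‖S z - a‖) 0 := by fun_prop
      exact this.eventually (gt_mem_nhds (by simpa [ha] using ha0))
    rw [hind.nhds_eq_comap, eventually_comap] at h1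
    have h2 : Tendsto (fun s : ℂ => s ^ 2 + w₀) (𝓝 (-a)) (𝓝 (f 0)) := by
      have : Tendsto (fun s : ℂ => s ^ 2 + w₀) (𝓝 (-a)) (𝓝 ((-a) ^ 2 + w₀)) :=
        Continuous.tendsto (by fun_prop) _
      rwa [neg_sq, hS2, sub_add_cancel] at this
    obtain ⟨ε, hε, hball⟩ := Metric.eventually_nhds_iff_ball.1
      ((h2.eventually h1).and (Metric.ball_mem_nhds (-a) (norm_pos_iff.2 ha0)))
    refine ⟨ε, hε, fun z => ?_⟩
    by_contra! hz
    have hz' : S z ∈ Metric.ball (-a) ε := by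
      rwa [Metric.mem_ball, dist_eq_norm, sub_neg_eq_add]
    obtain ⟨h3, h4⟩ := hball _ hz'
    have h5 := h3 z (by rw [hS2, sub_add_cancel])
    rw [dist_eq_norm, sub_neg_eq_add] at h4
    have h6 : ‖(2 : ℂ) * a‖ ≤ ‖S z + a‖ + ‖S z - a‖ := by
      rw [show (2 : ℂ) * a = (S z + a) - (S z - a) by ring]
      exact norm_sub_le _ _
    rw [norm_mul, Complex.norm_two] at h6
    linarith
  have hSa (z : ℂ) : S z + a ≠ 0 := norm_pos_iff.1 (hε.trans_le (hlow z))
  set g : ℂ → ℂ := fun z => (S z + a)⁻¹ with hg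
  have hS2c : ContDiff ℝ 2 S := (hL2.div_const 2).cexp
  have hg2 : ContDiff ℝ 2 g := (hS2c.add contDiff_const).inv hSa
  have hgM (z : ℂ) : ‖g z‖ ≤ ε⁻¹ := by
    rw [hg, norm_inv]
    exact inv_anti₀ hε (hlow z)
  have hder (z : ℂ) : HasDerivAt (fun l : ℂ => (exp (l / 2) + a)⁻¹)
      (-(S z / 2) / (S z + a) ^ 2) (L z) := by
    have h1 : HasDerivAt (fun l : ℂ => exp (l / 2) + a) (S z / 2) (L z) := by
      simpa [hS, div_eq_mul_inv] using (((hasDerivAt_id (L z)).div_const 2).cexp).add_const a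
    exact h1.inv (hSa z)
  have hLw (z : ℂ) := wirtinger_of_hasFDerivAt (a := (f z - w₀)⁻¹ * wirtingerZ f z)
    (b := (f z - w₀)⁻¹ * wirtingerZbar f z) (hL z) (fun v => by
      simp [fderiv_apply_eq_wirtinger]; ring)
  have hgw (z : ℂ) := wirtinger_comp (hder z) (hL z).differentiableAt
  -- g is a holomorphic function of L, and both Wirtinger derivatives of L are those of f divided by
  -- f - w₀, so the dilatation bound carries over.
  have hgk (z : ℂ) : ‖wirtingerZbar g z‖ ≤ k * ‖wirtingerZ g z‖ := by
    erw [(hgw z).1, (hgw z).2]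
    rw [(hLw z).1, (hLw z).2, ← mul_assoc, ← mul_assoc, norm_mul, norm_mul _ (wirtingerZ f z),
      mul_left_comm]
    gcongr
    exact hfk z
  have hz := wirtingerZ_eq_zero_of_bounded hg2 hgM hk0 hk hgk 0
  erw [(hgw 0).1] at hz
  rw [(hLw 0).1] at hz
  have hS0 : S 0 ≠ 0 := exp_ne_zero _
  exact mul_ne_zero (div_ne_zero (neg_ne_zero.2 (div_ne_zero hS0 two_ne_zero))
    (pow_ne_zero 2 (hSa 0))) (mul_ne_zero (inv_ne_zero (sub_ne_zero.2 (hw₀ 0))) hZ) hz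

theorem isLocallyL2On_of_continuous {g : ℂ → ℂ} (hg : Continuous g) (U : Set ℂ) :
    IsLocallyL2On g U := by
  intro C hC _
  have : IsFiniteMeasure (volume.restrict C) := isFiniteMeasure_restrict.2 hC.measure_lt_top.ne
  obtain ⟨M, hM⟩ := hC.exists_bound_of_continuousOn hg.continuousOn
  exact MemLp.of_bound hg.aestronglyMeasurable M
    ((ae_restrict_iff' hC.measurableSet).2 (Eventually.of_forall hM))

theorem hasWeakWirtinger_of_contDiff {f : ℂ → ℂ} (hf : ContDiff ℝ 1 f) :
    HasWeakWirtinger f (wirtingerZ f) (wirtingerZbar f) univ := by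
  intro φ hφ
  simp only [Measure.restrict_univ]
  exact integral_mul_wirtinger hf (hφ.smooth.of_le (by exact_mod_cast le_top)) hφ.hasCompactSupport

theorem isQuasiconformal_of_contDiff {f : ℂ → ℂ} {V : Set ℂ} {k : ℝ} (hf : ContDiff ℝ 1 f)
    (hhomeo : IsHomeoBetween f univ V) (hk0 : 0 ≤ k) (hk : k < 1)
    (hfk : ∀ z, ‖wirtingerZbar f z‖ = k * ‖wirtingerZ f z‖) :
    IsQuasiconformal ((1 + k) / (1 - k)) f univ V := by
  have hk1 : 0 < 1 - k := by linarith
  obtain ⟨hZ, hZb⟩ := contDiff_wirtinger (m := 0) hf (by norm_num)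
  refine ⟨by rw [le_div_iff₀ hk1]; linarith, hhomeo, wirtingerZ f, wirtingerZbar f,
    hasWeakWirtinger_of_contDiff hf, isLocallyL2On_of_continuous hZ.continuous univ,
    isLocallyL2On_of_continuous hZb.continuous univ, Eventually.of_forall fun z => ?_⟩
  rw [hfk]
  -- Equality holds pointwise: 1 + k = K(1 - k).
  refine le_of_eq ?_
  field_simp

theorem IsHomeoBetween.isInducing {f : ℂ → ℂ} {V : Set ℂ} (h : IsHomeoBetween f univ V) :
    IsInducing f := by
  obtain ⟨e, he⟩ := h
  have h1 : IsInducing (Subtype.val ∘ e ∘ (Homeomorph.Set.univ ℂ).symm) :=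
    IsInducing.subtypeVal.comp (e.isInducing.comp (Homeomorph.Set.univ ℂ).symm.isInducing)
  convert h1 using 1
  ext1 z
  exact (he ⟨z, mem_univ z⟩).symm

theorem IsHomeoBetween.range_eq {f : ℂ → ℂ} {V : Set ℂ} (h : IsHomeoBetween f univ V) :
    range f = V := by
  obtain ⟨e, he⟩ := h
  ext w
  constructor
  · rintro ⟨z, rfl⟩
    rw [← he ⟨z, mem_univ z⟩]
    exact (e _).2
  · intro hw
    refine ⟨e.symm ⟨w, hw⟩, ?_⟩
    rw [← he, e.apply_symm_apply]

end HarmonicPlane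

theorem mainTheorem5 (V : Set ℂ) (hV : HarmonicPlane.IsPlaneDomain V)
    (ρ : ℂ → ℝ) (hρ : HarmonicPlane.IsConformalMetricOn ρ V) (hflat : HarmonicPlane.IsFlatOn ρ V)
    (f : ℂ → ℂ) (hharm : HarmonicPlane.IsHarmonicMap f Set.univ V ρ)
    (hhomeo : HarmonicPlane.IsHomeoBetween f Set.univ V)
    (horient : HarmonicPlane.IsOrientationPreservingOn f Set.univ) :
    ∃ k : ℝ, 0 ≤ k ∧ k < 1 ∧
      (∀ z : ℂ, HarmonicPlane.wirtingerZ f z ≠ 0 ∧ ‖HarmonicPlane.beltrami f z‖ = k) ∧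
      HarmonicPlane.IsQuasiconformal ((1 + k) / (1 - k)) f Set.univ V ∧
      V = Set.univ := by
  have hf : ContDiff ℝ 2 f := contDiffOn_univ.1 hharm.contDiffOn
  have hrange := hhomeo.range_eq
  obtain ⟨k, hk0, hk1, hk⟩ := HarmonicPlane.exists_norm_wirtingerZbar_eq hf hV.1
    hhomeo.isInducing.injective hrange (fun z => horient z (mem_univ z))
    (HarmonicPlane.differentiableOn_logDensityZ hV.1 hρ hflat)
    (fun z => hharm.tension z (mem_univ z))
  refine ⟨k, hk0, hk1, fun z => ⟨(hk z).1, ?_⟩,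
    HarmonicPlane.isQuasiconformal_of_contDiff (hf.of_le (by norm_num)) hhomeo hk0 hk1
      (fun z => (hk z).2), ?_⟩
  · rw [HarmonicPlane.beltrami, norm_div, (hk z).2,
      mul_div_cancel_right₀ _ (norm_ne_zero_iff.2 (hk z).1)]
  · rw [← hrange]
    exact (HarmonicPlane.surjective_of_norm_wirtingerZbar_le hf hhomeo.isInducing hk0 hk1
      (fun z => (hk z).2.le) (hk 0).1).range_eq
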